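/- Let $L^2$ and $L^\infty$ denote the usual spaces of complex functions on the unit circle $\mathbb T$ with normalized Lebesgue measure, let $H^2\subset L^2$ be the subspace of functions whose negative Fourier coefficients vanish, and let $H^\infty=L^\infty\cap H^2$. An inner function is a $\theta\in H^\infty$ with $|\theta|=1$ a.e. on $\mathbb T$; its model space is $K_\theta=H^2\ominus\theta H^2$, and $P_\theta:L^2\to K_\theta$ is the orthogonal projection. Let $\mathcal J$ be the flip operator on $L^2$, $(\mathcal Jf)(\xi)=\bar\xi f(\bar\xi)$. Let $\mathcal R$ be the set of rational functions $p/q$ ($p,q$ polynomials, $q\neq0$) such that all zeros of $q$ lie in the open unit disk, regarded as functions on $\mathbb T$. A finite Blaschke product is a function $c\prod_{k=1}^n\frac{z-a_k}{1-\overline{a_k}z}$ with $n\ge 0$, $|c|=1$ and $|a_k|<1$ (unimodular constants, $n=0$, are included). Let $\phi\in L^\infty$ and let $\eta,\theta$ be inner functions. (i) The restricted Toeplitz operator $\mathcal T_\phi:\eta H^2\to K_\theta$, $\mathcal T_\phi(h)=P_\theta(\phi h)$, is of finite rank if and only if $\phi\in\bar\eta\theta(H^\infty+\mathcal R)$ or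 $\theta$ is a finite Blaschke product. (ii) The restricted Hankel operator $\mathcal H_\phi:\eta H^2\to K_\theta$, $\mathcal H_\phi(h)=P_\theta\mathcal J(\phi h)$, is of finite rank if and only if $\phi\in\bar\eta(H^\infty+\mathcal R)$ or $\theta$ is a finite Blaschke product. -/

import Mathlib

open MeasureTheory AddCircle Polynomial
open scoped ENNReal ComplexConjugate

noncomputable section

namespace RestrictedToeplitz

/-- The space `L²` of the unit circle. The circle is parametrized by `t ↦ e^{2πit}`, `t ∈ ℝ/ℤ`, and
carries the normalized Lebesgue (Haar) measure; `fourier n t = e^{2πint}` is the function `ξ ↦ ξⁿ`. -/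
abbrev L2 : Type := Lp ℂ 2 (haarAddCircle : Measure UnitAddCircle)

/-- The space `L^∞` of the unit circle. -/
abbrev Linf : Type := Lp ℂ ∞ (haarAddCircle : Measure UnitAddCircle)

/-- The Hardy space `H²`: the functions in `L²` whose negative Fourier coefficients vanish. -/
def H2 : Submodule ℂ L2 where
  carrier := {f | ∀ n : ℤ, n < 0 → fourierCoeff f n = 0}
  zero_mem' := fun n _ => by rw [← fourierBasis_repr, map_zero]; rfl
  add_mem' := fun {f g} hf hg n hn => by
    have h1 := hf n hn
    have h2 := hg n hn
    rw [← fourierBasis_repr] at h1 h2 ⊢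
    rw [map_add, lp.coeFn_add, Pi.add_apply, h1, h2, add_zero]
  smul_mem' := fun c f hf n hn => by
    have h1 := hf n hn
    rw [← fourierBasis_repr] at h1 ⊢
    rw [map_smul, lp.coeFn_smul, Pi.smul_apply, h1, smul_zero]

theorem isClosed_H2 : IsClosed (H2 : Set L2) := by
  have h : (H2 : Set L2) = ⋂ (n : ℤ) (_ : n < 0), {f : L2 | inner ℂ (fourierBasis n) f = 0} := by
    ext f
    simp only [Set.mem_iInter, Set.mem_ofPred_eq, ← HilbertBasis.repr_apply_apply,
      fourierBasis_repr]
    rfl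
  rw [h]
  exact isClosed_iInter fun n => isClosed_iInter fun _ =>
    isClosed_eq (continuous_const.inner continuous_id) continuous_const

/-- `H^∞ = L^∞ ∩ H²`. -/
def Hinf : Set Linf := {f | ∀ n : ℤ, n < 0 → fourierCoeff f n = 0}

/-- Inner functions: elements of `H^∞` that are unimodular almost everywhere on the circle. -/
def IsInner (θ : Linf) : Prop := θ ∈ Hinf ∧ ∀ᵐ t ∂haarAddCircle, ‖θ t‖ = 1

/-- The multiplication operator `M_φ f = φ f` on `L²`, for `φ ∈ L^∞`. -/
def mulOp (φ : Linf) : L2 →L[ℂ] L2 :=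
  (ContinuousLinearMap.mul ℂ ℂ).holderL haarAddCircle ∞ 2 2 φ

theorem mulOp_coeFn (φ : Linf) (f : L2) :
    mulOp φ f =ᵐ[haarAddCircle] fun t => φ t * f t :=
  (ContinuousLinearMap.mul ℂ ℂ).coeFn_holder φ f

theorem measurePreserving_neg : MeasurePreserving (fun t : UnitAddCircle => -t)
    haarAddCircle haarAddCircle :=
  Measure.measurePreserving_neg _

/-- The flip operator `(𝒥 f)(ξ) = ξ̄ f(ξ̄)` on `L²`. -/
def flipOp : L2 →L[ℂ] L2 :=
  mulOp (fourierLp ∞ (-1)) ∘L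
    (Lp.compMeasurePreservingₗᵢ ℂ (fun t : UnitAddCircle => -t)
      measurePreserving_neg).toContinuousLinearMap

theorem flipOp_coeFn (f : L2) :
    flipOp f =ᵐ[haarAddCircle] fun t => conj (fourier 1 t) * f (-t) := by
  refine (mulOp_coeFn _ _).trans ?_
  filter_upwards [coeFn_fourierLp (T := 1) ∞ (-1),
    Lp.coeFn_compMeasurePreserving f measurePreserving_neg] with t h1 h2
  rw [h1, fourier_neg]
  congr 1

/-- The Beurling subspace `η H²`. -/
def beurling (η : Linf) : Submodule ℂ L2 := H2.map (mulOp η).toLinearMap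

/-- The model space `K_θ = H² ⊖ θ H²`. -/
def modelSpace (θ : Linf) : Submodule ℂ L2 := H2 ⊓ (beurling θ)ᗮ

theorem isClosed_modelSpace (θ : Linf) : IsClosed (modelSpace θ : Set L2) :=
  isClosed_H2.inter (Submodule.isClosed_orthogonal _)

instance (θ : Linf) : CompleteSpace (modelSpace θ) :=
  (isClosed_modelSpace θ).completeSpace_coe

/-- The restricted Toeplitz operator `η H² → K_θ`, `h ↦ P_θ (φ h)`, where `P_θ` is the orthogonal
projection of `L²` onto `K_θ`. -/
def restrictedToeplitz (η θ φ : Linf) : beurling η →L[ℂ] modelSpace θ :=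
  (modelSpace θ).orthogonalProjectionOnto ∘L mulOp φ ∘L (beurling η).subtypeL

/-- The restricted Hankel operator `η H² → K_θ`, `h ↦ P_θ 𝒥 (φ h)`. -/
def restrictedHankel (η θ φ : Linf) : beurling η →L[ℂ] modelSpace θ :=
  (modelSpace θ).orthogonalProjectionOnto ∘L flipOp ∘L mulOp φ ∘L (beurling η).subtypeL

/-- A bounded operator has finite rank if its range is finite-dimensional. -/
def IsFiniteRank {E F : Type*} [NormedAddCommGroup E] [NormedSpace ℂ E]
    [NormedAddCommGroup F] [NormedSpace ℂ F] (T : E →L[ℂ] F) : Prop :=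
  FiniteDimensional ℂ T.range

/-- The set `ℛ` of (boundary values of) rational functions `p / q` such that all zeros of the
polynomial `q` lie in the open unit disk. -/
def ratl : Set Linf :=
  {r | ∃ p q : ℂ[X], q ≠ 0 ∧ (∀ z : ℂ, q.eval z = 0 → ‖z‖ < 1) ∧
    ∀ᵐ t ∂haarAddCircle, r t = p.eval (fourier 1 t) / q.eval (fourier 1 t)}

/-- The set `H^∞ + ℛ`. -/
def HinfAddRatl : Set Linf := {f | ∃ g ∈ Hinf, ∃ r ∈ ratl, f = g + r}

/-- `θ` is (the boundary function of) a finite Blaschke product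
`c ∏ (z - aₖ) / (1 - āₖ z)` with `|c| = 1` and `|aₖ| < 1`; the empty product is allowed. -/
def IsFiniteBlaschke (θ : Linf) : Prop :=
  ∃ (n : ℕ) (a : Fin n → ℂ) (c : ℂ), ‖c‖ = 1 ∧ (∀ k, ‖a k‖ < 1) ∧
    ∀ᵐ t ∂haarAddCircle,
      θ t = c * ∏ k, (fourier 1 t - a k) / (1 - conj (a k) * fourier 1 t)

end RestrictedToeplitz

end

open RestrictedToeplitz

open RestrictedToeplitz

namespace RestrictedToeplitz

/-! ### Fourier coefficients of functions on the circle -/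

/-! The kernel of `P_θ` is `θH² ⊕ (H²)ᗮ`. If the Toeplitz operator has finite rank, then `p ↦
P_θ(φηp)` is not injective on the infinite-dimensional space of polynomials, so `φηp = θa + b` for
some `p ≠ 0`, `a ∈ H²`, `b ⊥ H²`. If `b = 0`, then `p · (θ̄φη) ∈ H²`, and dividing by `p` root by
root puts `θ̄φη` in `H^∞ + ℛ` (`mem_HinfAddRatl_of_isHardy`). If `b ≠ 0`, replacing `p` by `ξⁿp`
puts every `P_θ(ξⁿb)` in the range. A triangular system then puts every `P_θ(ξᵏ)`, `k ≥ 0`, there,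
and these span a dense subspace of `K_θ`, so `K_θ` is finite-dimensional. Hence some nonzero
polynomial lies in `θH²`, and an inner divisor of a polynomial is a finite Blaschke product
(`isFiniteBlaschke_of_isHardy_conj_mul`). For the Hankel operator, `𝒥` exchanges `H²` and its
complement and turns `ξⁿ` into `ξ⁻ⁿ`; the cases become `a = 0` and `a ≠ 0`, with the vectors
`P_θ(θξ⁻¹⁻ᵏ)` as the total family. Conversely, `H²` is `qH²` plus the polynomials of degree less
than `deg q` when `q` has its zeros in the disk, so an operator killing `qH²` has finite rank on
`H²` (`finiteDimensional_map_H2`). This serves for symbols with denominator `q` and for finite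
Blaschke products. -/

theorem norm_fourier_apply (n : ℤ) (t : UnitAddCircle) : ‖(fourier n t : ℂ)‖ = 1 :=
  Circle.norm_coe _

theorem fourier_one_pow (n : ℕ) (t : UnitAddCircle) :
    (fourier 1 t : ℂ) ^ n = fourier (n : ℤ) t := by
  induction n with
  | zero => rw [pow_zero, Nat.cast_zero, fourier_zero]
  | succ n ih => rw [pow_succ, ih, Nat.cast_succ, fourier_add]

theorem fourierCoeff_fourier_mul (k : ℤ) (f : UnitAddCircle → ℂ) (n : ℤ) :
    fourierCoeff (fun t => fourier k t * f t) n = fourierCoeff f (n - k) := by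
  refine integral_congr_ae (Filter.Eventually.of_forall fun t => ?_)
  simp only [smul_eq_mul]
  rw [← mul_assoc, ← fourier_add, neg_sub, sub_eq_neg_add]

theorem fourierCoeff_add_apply {f g : UnitAddCircle → ℂ} (hf : MemLp f 2 haarAddCircle)
    (hg : MemLp g 2 haarAddCircle) (n : ℤ) :
    fourierCoeff (fun t => f t + g t) n = fourierCoeff f n + fourierCoeff g n :=
  congrFun (fourierCoeff.add (hf.integrable one_le_two) (hg.integrable one_le_two)) n

theorem fourierCoeff_sub_apply {f g : UnitAddCircle → ℂ} (hf : MemLp f 2 haarAddCircle)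
    (hg : MemLp g 2 haarAddCircle) (n : ℤ) :
    fourierCoeff (fun t => f t - g t) n = fourierCoeff f n - fourierCoeff g n := by
  have h := fourierCoeff_add_apply hf (hg.const_mul (-1)) n
  rw [fourierCoeff.const_mul] at h
  simpa only [neg_one_mul, ← sub_eq_add_neg] using h

theorem memLp_of_continuous {f : UnitAddCircle → ℂ} (hf : Continuous f) (p : ℝ≥0∞) :
    MemLp f p haarAddCircle :=
  hf.memLp_of_hasCompactSupport (HasCompactSupport.of_compactSpace f)

theorem continuous_eval_fourier (p : ℂ[X]) :
    Continuous fun t : UnitAddCircle => p.eval (fourier 1 t : ℂ) :=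
  p.continuous.comp (fourier 1).continuous

theorem memLp_mul {u f : UnitAddCircle → ℂ} {p : ℝ≥0∞} (hu : MemLp u ∞ haarAddCircle)
    (hf : MemLp f p haarAddCircle) : MemLp (fun t => u t * f t) p haarAddCircle :=
  MemLp.mul hf hu

theorem fourierCoeff_linear_mul {w : UnitAddCircle → ℂ} (hw : MemLp w 2 haarAddCircle)
    (α β : ℂ) (n : ℤ) :
    fourierCoeff (fun t => (α + β * fourier 1 t) * w t) n =
      α * fourierCoeff w n + β * fourierCoeff w (n - 1) := by
  have h1 : MemLp (fun t => fourier 1 t * w t) 2 haarAddCircle :=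
    memLp_mul (memLp_of_continuous (fourier 1).continuous _) hw
  rw [← fourierCoeff_fourier_mul, ← fourierCoeff.const_mul, ← fourierCoeff.const_mul,
    ← fourierCoeff_add_apply (hw.const_mul α) (h1.const_mul β)]
  congr 1
  funext t
  ring

theorem fourierCoeff_toLp {f : UnitAddCircle → ℂ} {p : ℝ≥0∞} (hf : MemLp f p haarAddCircle) :
    fourierCoeff (hf.toLp f) = fourierCoeff f :=
  fourierCoeff_congr_ae hf.coeFn_toLp

theorem tendsto_fourierCoeff_cofinite {f : UnitAddCircle → ℂ} (hf : MemLp f 2 haarAddCircle) :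
    Filter.Tendsto (fun n => ‖fourierCoeff f n‖) Filter.cofinite (nhds 0) := by
  have h := (hasSum_sq_fourierCoeff (hf.toLp f)).summable.tendsto_cofinite_zero
  rw [fourierCoeff_toLp] at h
  simpa using h.sqrt

/-- Coefficients of an `L²` function are square summable, so they tend to zero along any injective
sequence of indices. All divisions by linear factors below rest on this, without analytic
continuation into the disk. -/
theorem fourierCoeff_eq_zero_of_norm_le {f : UnitAddCircle → ℂ}
    (hf : MemLp f 2 haarAddCircle) {n : ℤ} {i : ℕ → ℤ} (hi : Function.Injective i)
    (h : ∀ k, ‖fourierCoeff f n‖ ≤ ‖fourierCoeff f (i k)‖) : fourierCoeff f n = 0 := by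
  have h1 := (tendsto_fourierCoeff_cofinite hf).comp hi.tendsto_cofinite
  exact norm_le_zero_iff.1 (ge_of_tendsto h1 (Filter.Eventually.of_forall h))

theorem eq_of_fourierCoeff_eq {f g : L2} (h : ∀ n, fourierCoeff f n = fourierCoeff g n) :
    f = g := by
  apply fourierBasis.repr.injective
  ext n
  rw [fourierBasis_repr, fourierBasis_repr, h]

theorem mem_H2 {f : L2} : f ∈ H2 ↔ ∀ n : ℤ, n < 0 → fourierCoeff f n = 0 := Iff.rfl

/-! ### Functions with vanishing negative Fourier coefficients -/

/-- A square integrable function whose negative Fourier coefficients vanish. -/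
structure IsHardy (f : UnitAddCircle → ℂ) : Prop where
  memLp : MemLp f 2 haarAddCircle
  coeff : ∀ n : ℤ, n < 0 → fourierCoeff f n = 0

namespace IsHardy

variable {f g : UnitAddCircle → ℂ}

theorem of_mem_H2 {f : L2} (hf : f ∈ H2) : IsHardy f := ⟨Lp.memLp f, hf⟩

theorem of_mem_Hinf {f : Linf} (hf : f ∈ Hinf) : IsHardy f :=
  ⟨(Lp.memLp f).mono_exponent le_top, hf⟩

theorem toLp_mem_H2 (hf : IsHardy f) : hf.memLp.toLp f ∈ H2 := fun n hn => by
  rw [fourierCoeff_toLp]; exact hf.coeff n hn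

theorem congr (hf : IsHardy f) (h : f =ᵐ[haarAddCircle] g) : IsHardy g :=
  ⟨hf.memLp.ae_eq h, by rw [← fourierCoeff_congr_ae h]; exact hf.coeff⟩

theorem mem_H2_of_ae_eq (hf : IsHardy f) {g : L2} (h : g =ᵐ[haarAddCircle] f) : g ∈ H2 :=
  (hf.congr h.symm).coeff

theorem add (hf : IsHardy f) (hg : IsHardy g) : IsHardy (fun t => f t + g t) :=
  ⟨hf.memLp.add hg.memLp, fun n hn => by
    rw [fourierCoeff_add_apply hf.memLp hg.memLp, hf.coeff n hn, hg.coeff n hn, add_zero]⟩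

theorem const_mul (hf : IsHardy f) (c : ℂ) : IsHardy (fun t => c * f t) :=
  ⟨hf.memLp.const_mul c, fun n hn => by rw [fourierCoeff.const_mul, hf.coeff n hn, mul_zero]⟩

theorem sub (hf : IsHardy f) (hg : IsHardy g) : IsHardy (fun t => f t - g t) :=
  ⟨hf.memLp.sub hg.memLp, fun n hn => by
    rw [fourierCoeff_sub_apply hf.memLp hg.memLp, hf.coeff n hn, hg.coeff n hn, sub_zero]⟩

theorem fourier_mul (hf : IsHardy f) {k : ℤ} (hk : 0 ≤ k) :
    IsHardy (fun t => fourier k t * f t) :=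
  ⟨memLp_mul (memLp_of_continuous (fourier k).continuous _) hf.memLp, fun n hn => by
    rw [fourierCoeff_fourier_mul]; exact hf.coeff _ (by lia)⟩

/-- Boundedness of `f` makes multiplication by `f` continuous on `L²`, so the `g` with `fg ∈ H²`
form a closed subspace. It contains `ξⁱ` for `i ≥ 0`, hence the sum of the Fourier series of any
Hardy `g`. -/
theorem mul (hu : IsHardy f) (hb : MemLp f ∞ haarAddCircle) (hg : IsHardy g) :
    IsHardy (fun t => f t * g t) := by
  have key : hg.memLp.toLp g ∈ H2.comap (mulOp (hb.toLp f)).toLinearMap := by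
    have hclosed : IsClosed (H2.comap (mulOp (hb.toLp f)).toLinearMap : Set L2) :=
      isClosed_H2.preimage (mulOp (hb.toLp f)).continuous
    refine hclosed.mem_of_tendsto (hasSum_fourier_series_L2 _)
      (Filter.Eventually.of_forall fun s => Submodule.sum_mem _ fun i _ => ?_)
    rw [fourierCoeff_toLp]
    rcases lt_or_ge i 0 with hi | hi
    · rw [hg.coeff i hi, zero_smul]
      exact Submodule.zero_mem _
    · refine Submodule.smul_mem _ _ ((hu.fourier_mul hi).mem_H2_of_ae_eq ?_)
      filter_upwards [mulOp_coeFn (hb.toLp f) (fourierLp 2 i), hb.coeFn_toLp,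
        coeFn_fourierLp (T := 1) 2 i] with t h1 h2 h3
      rw [ContinuousLinearMap.coe_coe, h1, h2, h3, mul_comm]
  refine (of_mem_H2 key).congr ?_
  filter_upwards [mulOp_coeFn (hb.toLp f) (hg.memLp.toLp g), hb.coeFn_toLp,
    hg.memLp.coeFn_toLp] with t h1 h2 h3
  rw [ContinuousLinearMap.coe_coe, h1, h2, h3]

theorem const (c : ℂ) : IsHardy fun _ => c := by
  refine ⟨memLp_const c, fun n hn => ?_⟩
  have h := congrFun (fourierCoeff_congr_ae (coeFn_fourierLp (T := 1) 2 0)) n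
  rw [← fourierBasis_repr, ← coe_fourierBasis, HilbertBasis.repr_self,
    lp.single_apply_ne _ _ _ hn.ne] at h
  have h2 : (fun _ : UnitAddCircle => c) = fun t => c * fourier 0 t := by
    funext t
    rw [fourier_zero, mul_one]
  rw [h2, fourierCoeff.const_mul, ← h, mul_zero]

theorem eval (p : ℂ[X]) : IsHardy fun t => p.eval (fourier 1 t : ℂ) := by
  induction p using Polynomial.induction_on' with
  | add p q hp hq => simpa only [eval_add] using hp.add hq
  | monomial n c =>
    simp only [eval_monomial, fourier_one_pow, mul_comm c]
    exact (const c).fourier_mul (Int.natCast_nonneg n)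

theorem eval_mul (hf : IsHardy f) (p : ℂ[X]) :
    IsHardy fun t => p.eval (fourier 1 t : ℂ) * f t :=
  (eval p).mul (memLp_of_continuous (continuous_eval_fourier p) _) hf

/-- Division by a linear polynomial without zeros in the open disk. -/
theorem of_linear_mul (hf : MemLp f 2 haarAddCircle) {α β : ℂ} (hα : α ≠ 0) (h : ‖β‖ ≤ ‖α‖)
    (H : IsHardy fun t => (α + β * fourier 1 t) * f t) : IsHardy f := by
  -- For `n < 0` the product has zero coefficient, so `α f̂(n) = -β f̂(n-1)`: the moduli cannot
  -- decrease towards `-∞`. Equality `‖β‖ = ‖α‖`, a zero on the circle, is allowed.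
  have step : ∀ n : ℤ, n < 0 → ‖fourierCoeff f n‖ ≤ ‖fourierCoeff f (n - 1)‖ := fun n hn => by
    have h1 := H.coeff n hn
    rw [fourierCoeff_linear_mul hf, add_eq_zero_iff_eq_neg] at h1
    have h2 := congrArg norm h1
    rw [norm_neg, norm_mul, norm_mul] at h2
    refine le_of_mul_le_mul_left ?_ (norm_pos_iff.2 hα)
    rw [h2]
    gcongr
  refine ⟨hf, fun n hn => fourierCoeff_eq_zero_of_norm_le hf (i := fun k => n - k)
    (fun a b hab => by simpa using hab) fun k => ?_⟩
  induction k with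
  | zero => simp
  | succ k ih =>
    refine ih.trans ((step _ (by lia)).trans_eq ?_)
    rw [Nat.cast_succ, sub_sub]

end IsHardy

/-! ### The Cauchy kernel. -/

theorem fourier_sub_ne_zero {a : ℂ} (ha : ‖a‖ < 1) (t : UnitAddCircle) :
    (fourier 1 t : ℂ) - a ≠ 0 := by
  intro h
  rw [sub_eq_zero] at h
  rw [← h, norm_fourier_apply] at ha
  exact lt_irrefl _ ha

theorem memLp_inv_fourier_sub {a : ℂ} (ha : ‖a‖ < 1) (p : ℝ≥0∞) :
    MemLp (fun t : UnitAddCircle => ((fourier 1 t : ℂ) - a)⁻¹) p haarAddCircle :=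
  memLp_of_continuous (((fourier 1).continuous.sub continuous_const).inv₀
    (fourier_sub_ne_zero ha)) _

/-- Comparing coefficients in `(ξ - a)v = 1` gives `v̂(n-1) - a v̂(n) = δₙ₀`. Since `‖a‖ < 1`, the
moduli do not decrease from `n = 0` upwards, so `v̂(0) = 0`, and `n = 0` then gives `v̂(-1) = 1`. -/
theorem fourierCoeff_inv_fourier_sub {a : ℂ} (ha : ‖a‖ < 1) :
    fourierCoeff (fun t : UnitAddCircle => ((fourier 1 t : ℂ) - a)⁻¹) (-1) = 1 := by
  have hv := memLp_inv_fourier_sub ha 2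
  set v := fun t : UnitAddCircle => ((fourier 1 t : ℂ) - a)⁻¹ with hvdef
  have h1 : (fun t => (-a + 1 * fourier 1 t) * v t) = fun t : UnitAddCircle => fourier 0 t * 1 := by
    funext t
    rw [fourier_zero, one_mul, neg_add_eq_sub, hvdef, mul_inv_cancel₀ (fourier_sub_ne_zero ha t),
      one_mul]
  have hone : ∀ n : ℤ, fourierCoeff (fun t : UnitAddCircle => (fourier 0 t : ℂ) * 1) n =
      if n = 0 then 1 else 0 := by
    intro n
    simp only [mul_one]
    rw [← fourierCoeff_congr_ae (coeFn_fourierLp (T := 1) 2 0), ← fourierBasis_repr,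
      ← coe_fourierBasis, HilbertBasis.repr_self, lp.single_apply]
    simp [Pi.single_apply]
  have hrec : ∀ n : ℤ, -a * fourierCoeff v n + fourierCoeff v (n - 1) = if n = 0 then 1 else 0 := by
    intro n
    rw [← hone, ← h1, fourierCoeff_linear_mul hv, one_mul]
  have h0 : fourierCoeff v 0 = 0 := by
    refine fourierCoeff_eq_zero_of_norm_le hv (i := fun k => (k : ℤ)) Nat.cast_injective fun k => ?_
    induction k with
    | zero => simp
    | succ k ih =>
      have h := hrec (k + 1)
      rw [if_neg (by lia), add_sub_cancel_right, neg_mul, neg_add_eq_zero] at h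
      rw [← h, norm_mul] at ih
      push_cast
      exact ih.trans (mul_le_of_le_one_left (norm_nonneg _) ha.le)
  simpa [h0] using hrec 0

/-- Division by a linear polynomial with a zero in the open disk, up to a multiple of the Cauchy
kernel. -/
theorem IsHardy.sub_div {w : UnitAddCircle → ℂ} (hw : MemLp w 2 haarAddCircle) {a : ℂ}
    (ha : ‖a‖ < 1) (H : IsHardy fun t => ((fourier 1 t : ℂ) - a) * w t) :
    ∃ c : ℂ, IsHardy fun t => w t - c * ((fourier 1 t : ℂ) - a)⁻¹ := by
  set c := fourierCoeff w (-1)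
  have hv := (memLp_inv_fourier_sub ha 2).const_mul c
  have hd : MemLp (fun t => w t - c * ((fourier 1 t : ℂ) - a)⁻¹) 2 haarAddCircle := hw.sub hv
  refine ⟨c, hd, ?_⟩
  have hd1 : fourierCoeff (fun t => w t - c * ((fourier 1 t : ℂ) - a)⁻¹) (-1) = 0 := by
    rw [fourierCoeff_sub_apply hw hv, fourierCoeff.const_mul, fourierCoeff_inv_fourier_sub ha,
      mul_one, sub_self]
  -- Multiplying the difference `d` by `ξ - a` gives `(ξ - a)w - c`, still Hardy. Hence `d̂(n-1) = a
  -- d̂(n)` for `n < 0`, and the zero at `-1` arranged by the choice of `c` propagates downwards.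
  have hH := H.sub (IsHardy.const c)
  have key : ∀ k : ℕ, fourierCoeff (fun t => w t - c * ((fourier 1 t : ℂ) - a)⁻¹) (-1 - k) = 0 := by
    intro k
    induction k with
    | zero => simpa using hd1
    | succ k ih =>
      have h := fourierCoeff_linear_mul hd (-a) 1 (-1 - k)
      rw [ih, mul_zero, zero_add, one_mul] at h
      rw [Nat.cast_succ, ← sub_sub, ← h, ← hH.coeff (-1 - k) (by lia)]
      congr 1
      funext t
      have := fourier_sub_ne_zero ha t
      field_simp
      ring
  intro n hn
  obtain ⟨k, rfl⟩ : ∃ k : ℕ, n = -1 - k := ⟨(-1 - n).toNat, by lia⟩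
  exact key k

/-! ### Division by polynomials -/

theorem polynomial_induction_linear {motive : ∀ p : ℂ[X], p ≠ 0 → Prop}
    (hC : ∀ (c : ℂ) (hc : c ≠ 0), motive (C c) (C_ne_zero.2 hc))
    (hmul : ∀ (a : ℂ) (p : ℂ[X]) (hp : p ≠ 0), motive p hp →
      motive ((X - C a) * p) (mul_ne_zero (X_sub_C_ne_zero a) hp))
    (p : ℂ[X]) (hp : p ≠ 0) : motive p hp := by
  induction h : p.natDegree generalizing p with
  | zero =>
    rw [natDegree_eq_zero] at h
    obtain ⟨c, rfl⟩ := h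
    exact hC c (C_ne_zero.1 hp)
  | succ n ih =>
    obtain ⟨a, ha⟩ := IsAlgClosed.exists_root p (by
      intro h0
      rw [natDegree_eq_of_degree_eq_some h0] at h
      simp at h)
    obtain ⟨q, rfl⟩ := dvd_iff_isRoot.2 ha
    have hq : q ≠ 0 := right_ne_zero_of_mul hp
    refine hmul a q hq (ih q hq ?_)
    rw [natDegree_mul (X_sub_C_ne_zero a) hq, natDegree_X_sub_C] at h
    lia

theorem eval_fourier_ne_zero {q : ℂ[X]} (hq : ∀ z : ℂ, q.eval z = 0 → ‖z‖ < 1)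
    (t : UnitAddCircle) : q.eval (fourier 1 t : ℂ) ≠ 0 := fun h => by
  have := hq _ h
  rw [norm_fourier_apply] at this
  exact lt_irrefl _ this

theorem memLp_eval_div_eval (p : ℂ[X]) {q : ℂ[X]} (hq : ∀ z : ℂ, q.eval z = 0 → ‖z‖ < 1)
    (r : ℝ≥0∞) : MemLp (fun t : UnitAddCircle => p.eval (fourier 1 t : ℂ) / q.eval (fourier 1 t : ℂ))
      r haarAddCircle :=
  memLp_of_continuous ((continuous_eval_fourier p).div (continuous_eval_fourier q)
    (eval_fourier_ne_zero hq)) _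

/-- Zeros outside the open disk can be divided out. -/
theorem IsHardy.exists_zeros_mem_disk {p : ℂ[X]} (hp : p ≠ 0) {w : UnitAddCircle → ℂ}
    (hw : MemLp w 2 haarAddCircle) (H : IsHardy fun t => p.eval (fourier 1 t : ℂ) * w t) :
    ∃ q : ℂ[X], q ≠ 0 ∧ (∀ z : ℂ, q.eval z = 0 → ‖z‖ < 1) ∧
      IsHardy fun t => q.eval (fourier 1 t : ℂ) * w t := by
  induction p, hp using polynomial_induction_linear generalizing w with
  | hC c hc => exact ⟨C c, C_ne_zero.2 hc, fun z hz => absurd (by simpa using hz) hc, H⟩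
  | hmul a p hp ih =>
    obtain ⟨q, hq0, hq, Hq⟩ := ih (w := fun t => ((fourier 1 t : ℂ) - a) * w t)
      (memLp_mul (memLp_of_continuous ((fourier 1).continuous.sub continuous_const) _) hw)
      (by convert H using 2 with t; simp only [Polynomial.eval_mul, eval_sub, eval_X, eval_C]; ring)
    -- A root in the open disk stays in `q`; a factor `ξ - a` with `‖a‖ ≥ 1` is cancelled by
    -- `of_linear_mul`.
    rcases lt_or_ge ‖a‖ 1 with ha | ha
    · refine ⟨(X - C a) * q, mul_ne_zero (X_sub_C_ne_zero a) hq0, fun z hz => ?_, ?_⟩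
      · simp only [Polynomial.eval_mul, eval_sub, eval_X, eval_C, mul_eq_zero, sub_eq_zero] at hz
        rcases hz with rfl | hz
        exacts [ha, hq z hz]
      · convert Hq using 2 with t
        simp only [Polynomial.eval_mul, eval_sub, eval_X, eval_C]
        ring
    · refine ⟨q, hq0, hq, IsHardy.of_linear_mul (α := -a) (β := 1)
        (memLp_mul (memLp_of_continuous (continuous_eval_fourier q) _) hw) ?_ ?_ ?_⟩
      · rw [neg_ne_zero]; rintro rfl; simp at ha; linarith
      · simpa using ha
      · convert Hq using 2 with t
        ring

/-- Division by a polynomial with all zeros in the open disk. -/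
theorem IsHardy.sub_eval_div_eval {q : ℂ[X]} (hq0 : q ≠ 0) (hq : ∀ z : ℂ, q.eval z = 0 → ‖z‖ < 1)
    {w : UnitAddCircle → ℂ} (hw : MemLp w 2 haarAddCircle)
    (H : IsHardy fun t => q.eval (fourier 1 t : ℂ) * w t) :
    ∃ p : ℂ[X], p.degree < q.degree ∧
      IsHardy fun t => w t - p.eval (fourier 1 t : ℂ) / q.eval (fourier 1 t : ℂ) := by
  induction q, hq0 using polynomial_induction_linear generalizing w with
  | hC c hc =>
    refine ⟨0, by rw [degree_C hc, degree_zero]; exact WithBot.bot_lt_coe 0, ?_⟩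
    convert H.const_mul c⁻¹ using 2 with t
    simp [hc]
  | hmul a q hq0 ih =>
    have ha : ‖a‖ < 1 := hq a (by simp)
    have hq' : ∀ z : ℂ, q.eval z = 0 → ‖z‖ < 1 := fun z hz => hq z (by simp [hz])
    obtain ⟨p, hp, Hp⟩ := ih hq' (w := fun t => ((fourier 1 t : ℂ) - a) * w t)
      (memLp_mul (memLp_of_continuous ((fourier 1).continuous.sub continuous_const) _) hw)
      (by convert H using 2 with t; simp only [Polynomial.eval_mul, eval_sub, eval_X, eval_C]; ring)
    have hmem : MemLp (fun t : UnitAddCircle => w t - p.eval (fourier 1 t : ℂ) /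
        ((X - C a) * q).eval (fourier 1 t : ℂ)) 2 haarAddCircle :=
      hw.sub (memLp_eval_div_eval p hq 2)
    obtain ⟨c, hc⟩ := IsHardy.sub_div hmem ha (by
      convert Hp using 2 with t
      have h1 := fourier_sub_ne_zero ha t
      have h2 := eval_fourier_ne_zero hq' t
      simp only [Polynomial.eval_mul, eval_sub, eval_X, eval_C]
      field_simp)
    -- The two corrections add up: `p/((z-a)q) + c/(z-a) = (p + cq)/((z-a)q)`.
    refine ⟨p + C c * q, ?_, ?_⟩
    · have hlt : q.degree < ((X - C a) * q).degree := by
        rw [degree_mul, degree_X_sub_C, degree_eq_natDegree hq0]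
        norm_cast
        lia
      refine (degree_add_le _ _).trans_lt (max_lt (hp.trans hlt) (lt_of_le_of_lt ?_ hlt))
      rw [degree_mul]
      exact (add_le_add_left degree_C_le _).trans_eq (zero_add _)
    · convert hc using 2 with t
      have h1 := fourier_sub_ne_zero ha t
      have h2 := eval_fourier_ne_zero hq' t
      simp only [Polynomial.eval_mul, eval_sub, eval_X, eval_C, eval_add]
      field_simp
      ring

/-! ### The Hardy space and its orthogonal complement -/

instance : CompleteSpace H2 := isClosed_H2.completeSpace_coe

theorem fourierCoeff_eq_inner (f : L2) (n : ℤ) : fourierCoeff f n = inner ℂ (fourierLp 2 n) f := by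
  rw [← fourierBasis_repr, HilbertBasis.repr_apply_apply, coe_fourierBasis]

theorem fourierCoeff_fourierLp (k n : ℤ) :
    fourierCoeff (fourierLp (T := 1) 2 k) n = if n = k then 1 else 0 := by
  rw [← fourierBasis_repr, ← coe_fourierBasis, HilbertBasis.repr_self, lp.single_apply]
  simp [Pi.single_apply]

theorem fourierCoeff_sub_L2 (f g : L2) (n : ℤ) :
    fourierCoeff (f - g : L2) n = fourierCoeff f n - fourierCoeff g n := by
  simp only [fourierCoeff_eq_inner, inner_sub_right]

theorem fourierCoeff_sum_smul_L2 {ι : Type*} (s : Finset ι) (c : ι → ℂ) (f : ι → L2) (n : ℤ) :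
    fourierCoeff (∑ i ∈ s, c i • f i : L2) n = ∑ i ∈ s, c i * fourierCoeff (f i) n := by
  simp only [fourierCoeff_eq_inner, inner_sum, inner_smul_right]

theorem eq_zero_of_fourierCoeff {f : L2} (h : ∀ n, fourierCoeff f n = 0) : f = 0 :=
  eq_of_fourierCoeff_eq fun n => by rw [h, fourierCoeff_eq_inner, inner_zero_right]

theorem fourierLp_mem_H2 {k : ℤ} (hk : 0 ≤ k) : fourierLp 2 k ∈ H2 := fun n hn => by
  rw [fourierCoeff_fourierLp, if_neg (by lia)]

theorem mem_H2_orthogonal {b : L2} : b ∈ H2ᗮ ↔ ∀ n : ℤ, 0 ≤ n → fourierCoeff b n = 0 := by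
  constructor
  · intro hb n hn
    rw [fourierCoeff_eq_inner]
    exact hb _ (fourierLp_mem_H2 hn)
  · intro hb f hf
    rw [← HilbertBasis.tsum_inner_mul_inner fourierBasis]
    refine (tsum_congr fun n => ?_).trans tsum_zero
    rw [coe_fourierBasis, ← fourierCoeff_eq_inner]
    rcases lt_or_ge n 0 with hn | hn
    · rw [← inner_conj_symm, ← fourierCoeff_eq_inner, hf n hn, map_zero, zero_mul]
    · rw [hb n hn, mul_zero]

/-! ### Multiplication operators -/

theorem mulOp_eq_of_ae {u : Linf} {f g : L2} (h : ∀ᵐ t ∂haarAddCircle, g t = u t * f t) :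
    mulOp u f = g := by
  ext1
  filter_upwards [mulOp_coeFn u f, h] with t h1 h2
  rw [h1, h2]

theorem mulOp_comm (u v : Linf) (f : L2) : mulOp u (mulOp v f) = mulOp v (mulOp u f) := by
  refine mulOp_eq_of_ae ?_
  filter_upwards [mulOp_coeFn v (mulOp u f), mulOp_coeFn u f, mulOp_coeFn v f] with t h1 h2 h3
  rw [h1, h2, h3]
  ring

theorem inner_mulOp_left (u : Linf) (f g : L2) :
    inner ℂ (mulOp u f) g = inner ℂ f (mulOp (star u) g) := by
  rw [L2.inner_def, L2.inner_def]
  refine integral_congr_ae ?_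
  filter_upwards [mulOp_coeFn u f, mulOp_coeFn (star u) g, Lp.coeFn_star u] with t h1 h2 h3
  rw [h1, h2, h3, Pi.star_apply]
  simp only [RCLike.inner_apply, map_mul, RCLike.star_def]
  ring

theorem conj_mul_self_of_norm_eq_one {z : ℂ} (hz : ‖z‖ = 1) : conj z * z = 1 := by
  rw [Complex.conj_mul', hz]
  norm_num

theorem mulOp_star_mulOp {θ : Linf} (hθ : IsInner θ) (f : L2) :
    mulOp (star θ) (mulOp θ f) = f := by
  refine mulOp_eq_of_ae ?_
  filter_upwards [mulOp_coeFn θ f, Lp.coeFn_star θ, hθ.2] with t h1 h2 h3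
  rw [h1, h2, Pi.star_apply, RCLike.star_def, ← mul_assoc, conj_mul_self_of_norm_eq_one h3, one_mul]

theorem mulOp_mem_H2 {u : Linf} (hu : u ∈ Hinf) {f : L2} (hf : f ∈ H2) : mulOp u f ∈ H2 :=
  ((IsHardy.of_mem_Hinf hu).mul (Lp.memLp u) (.of_mem_H2 hf)).mem_H2_of_ae_eq (mulOp_coeFn u f)

theorem fourierCoeff_mulOp_fourierLp (k : ℤ) (f : L2) (n : ℤ) :
    fourierCoeff (mulOp (fourierLp ∞ k) f) n = fourierCoeff f (n - k) := by
  rw [← fourierCoeff_fourier_mul]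
  refine congrFun (fourierCoeff_congr_ae ?_) n
  filter_upwards [mulOp_coeFn (fourierLp ∞ k) f, coeFn_fourierLp (T := 1) ∞ k] with t h1 h2
  rw [h1, h2]

theorem fourierCoeff_flipOp (f : L2) (n : ℤ) :
    fourierCoeff (flipOp f) n = fourierCoeff f (-n - 1) := by
  rw [fourierCoeff_congr_ae (flipOp_coeFn f), fourierCoeff, fourierCoeff,
    ← measurePreserving_neg.integral_comp (Homeomorph.neg UnitAddCircle).measurableEmbedding]
  refine integral_congr_ae (Filter.Eventually.of_forall fun t => ?_)
  simp only [smul_eq_mul]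
  have h : (fourier (-(-n - 1)) t : ℂ) = fourier (-n) (-t) * conj (fourier 1 (-t) : ℂ) := by
    rw [← fourier_neg, ← fourier_add, fourier_apply, fourier_apply, smul_neg, ← neg_smul]
    congr 3
  rw [h, mul_assoc, neg_neg]

theorem flipOp_mulOp_fourierLp (k : ℤ) (f : L2) :
    flipOp (mulOp (fourierLp ∞ k) f) = mulOp (fourierLp ∞ (-k)) (flipOp f) :=
  eq_of_fourierCoeff_eq fun n => by
    rw [fourierCoeff_flipOp, fourierCoeff_mulOp_fourierLp, fourierCoeff_mulOp_fourierLp,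
      fourierCoeff_flipOp]
    congr 1
    ring

theorem flipOp_mem_H2_orthogonal_iff {f : L2} : flipOp f ∈ H2ᗮ ↔ f ∈ H2 := by
  rw [mem_H2_orthogonal]
  constructor
  · intro h n hn
    have := h (-n - 1) (by lia)
    rw [fourierCoeff_flipOp] at this
    rw [← this]
    congr 1
    ring
  · intro h n hn
    rw [fourierCoeff_flipOp]
    exact h _ (by lia)

/-- Polynomials as elements of `L²`. -/
noncomputable def polyL2 : ℂ[X] →ₗ[ℂ] L2 :=
  (ContinuousMap.toLp 2 haarAddCircle ℂ).toLinearMap ∘ₗ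
    (aeval (fourier 1 : C(UnitAddCircle, ℂ))).toLinearMap

theorem polyL2_coeFn (p : ℂ[X]) :
    polyL2 p =ᵐ[haarAddCircle] fun t => p.eval (fourier 1 t : ℂ) := by
  refine (ContinuousMap.coeFn_toLp haarAddCircle _).trans (Filter.Eventually.of_forall fun t => ?_)
  exact aeval_continuousMap_apply p _ t

theorem polyL2_mem_H2 (p : ℂ[X]) : polyL2 p ∈ H2 :=
  (IsHardy.eval p).mem_H2_of_ae_eq (polyL2_coeFn p)

theorem mulOp_polyL2 (k : ℕ) (p : ℂ[X]) :
    mulOp (fourierLp ∞ (k : ℤ)) (polyL2 p) = polyL2 (X ^ k * p) := by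
  refine mulOp_eq_of_ae ?_
  filter_upwards [polyL2_coeFn (X ^ k * p), coeFn_fourierLp (T := 1) ∞ k, polyL2_coeFn p]
    with t h1 h2 h3
  rw [h1, h2, h3, Polynomial.eval_mul, eval_pow, eval_X, fourier_one_pow]

/-! ### The model space -/

/-- The orthogonal projection onto the model space. -/
noncomputable abbrev modelProj (θ : Linf) : L2 →L[ℂ] modelSpace θ :=
  (modelSpace θ).orthogonalProjectionOnto

theorem modelProj_eq_zero_of_mem_orthogonal (θ : Linf) {b : L2} (hb : b ∈ H2ᗮ) :
    modelProj θ b = 0 :=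
  Submodule.orthogonalProjectionOnto_eq_zero_iff.2 (Submodule.orthogonal_le inf_le_left hb)

theorem modelProj_mulOp (θ : Linf) {a : L2} (ha : a ∈ H2) : modelProj θ (mulOp θ a) = 0 :=
  Submodule.orthogonalProjectionOnto_eq_zero_iff.2 fun _ hf =>
    Submodule.inner_left_of_mem_orthogonal (Submodule.mem_map_of_mem ha) hf.2

/-- This is the decomposition `L² = θH² ⊕ K_θ ⊕ (H²)ᗮ`. Because `‖θ‖ = 1`, the `θH²` component of
`x₁ ∈ H²` is `θ` times the `H²` projection of `θ̄x₁`. -/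
theorem exists_of_modelProj_eq_zero {θ : Linf} (hθ : IsInner θ) {x : L2}
    (hx : modelProj θ x = 0) : ∃ a ∈ H2, ∃ b ∈ H2ᗮ, x = mulOp θ a + b := by
  set x₁ := H2.starProjection x
  set a := H2.starProjection (mulOp (star θ) x₁)
  have hx₁ : x₁ ∈ H2 := Submodule.starProjection_apply_mem _ _
  have ha : a ∈ H2 := Submodule.starProjection_apply_mem _ _
  have hb : x - x₁ ∈ H2ᗮ := Submodule.sub_starProjection_mem_orthogonal x
  have hy : x₁ - mulOp θ a ∈ modelSpace θ := by
    refine ⟨Submodule.sub_mem _ hx₁ (mulOp_mem_H2 hθ.1 ha), ?_⟩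
    rintro _ ⟨h, hh, rfl⟩
    rw [ContinuousLinearMap.coe_coe, inner_mulOp_left, map_sub, mulOp_star_mulOp hθ]
    exact Submodule.sub_starProjection_mem_orthogonal (mulOp (star θ) x₁) h hh
  -- The `K_θ` component is orthogonal to `x`, to `x - x₁` and to `θa`, hence to itself.
  have hy0 : x₁ - mulOp θ a = 0 := by
    rw [← inner_self_eq_zero (𝕜 := ℂ)]
    have h1 := Submodule.orthogonalProjectionOnto_eq_zero_iff.1 hx _ hy
    have h2 : inner ℂ (x₁ - mulOp θ a) (x - x₁) = 0 := hb _ hy.1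
    have h3 : inner ℂ (x₁ - mulOp θ a) (mulOp θ a) = 0 :=
      Submodule.inner_left_of_mem_orthogonal (Submodule.mem_map_of_mem ha) hy.2
    rw [inner_sub_right] at h2 ⊢
    rw [h1, zero_sub, neg_eq_zero] at h2
    rw [h2, h3, sub_zero]
  refine ⟨a, ha, x - x₁, hb, ?_⟩
  rw [sub_eq_zero] at hy0
  rw [← hy0, add_sub_cancel]

/-- For `f ∈ K_θ`, `⟨e i, f⟩ = ⟨P_θ(e i), f⟩`, so `f ⊥ W` forces `f = 0`. As `W` is
finite-dimensional, a trivial complement means that `W` is everything. -/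
theorem finiteDimensional_modelSpace_of_total {θ : Linf} (W : Submodule ℂ (modelSpace θ))
    [FiniteDimensional ℂ W] {ι : Type*} (e : ι → L2) (he : ∀ i, modelProj θ (e i) ∈ W)
    (htot : ∀ f ∈ modelSpace θ, (∀ i, inner ℂ (e i) f = 0) → f = 0) :
    FiniteDimensional ℂ (modelSpace θ) := by
  have hW : W = ⊤ := by
    rw [← Submodule.orthogonal_eq_bot_iff, Submodule.eq_bot_iff]
    intro f hf
    refine Subtype.ext (htot f f.2 fun i => ?_)
    rw [← Submodule.inner_orthogonalProjectionOnto_eq_of_mem_right]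
    exact hf _ (he i)
  subst hW
  exact Module.Finite.equiv (Submodule.topEquiv (R := ℂ) (M := modelSpace θ))

/-- Let `m` be the first index with `c m ≠ 0`. In the sum for `n = m + j` the terms with `k > j`
vanish, those with `k < j` lie in `W` by induction, and `e j` has the invertible coefficient `c m`.
-/
theorem mem_of_convolution_mem {V : Type*} [AddCommGroup V] [Module ℂ V] {W : Submodule ℂ V}
    {e : ℕ → V} {c : ℕ → ℂ} (hc : ∃ i, c i ≠ 0)
    (h : ∀ n, ∑ k ∈ Finset.range (n + 1), c (n - k) • e k ∈ W) (j : ℕ) : e j ∈ W := by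
  classical
  induction j using Nat.strong_induction_on with
  | _ j ih =>
    have h1 := h (Nat.find hc + j)
    rw [← Finset.add_sum_erase _ _ (Finset.mem_range.2 (by lia : j < Nat.find hc + j + 1)),
      Submodule.add_mem_iff_left, Nat.add_sub_cancel] at h1
    · exact (W.smul_mem_iff (Nat.find_spec hc)).1 h1
    · refine Submodule.sum_mem _ fun k hk => ?_
      rw [Finset.mem_erase, Finset.mem_range] at hk
      rcases lt_or_gt_of_ne hk.1 with hkj | hkj
      · exact W.smul_mem _ (ih k hkj)
      · rw [not_ne_iff.1 (Nat.find_min hc (by lia : Nat.find hc + j - k < Nat.find hc)), zero_smul]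
        exact W.zero_mem

/-- If the projections to `K_θ` of all `ξⁿ b` lie in a finite-dimensional space, where `b ≠ 0` is
orthogonal to `H²`, then `K_θ` is finite-dimensional. -/
theorem finiteDimensional_modelSpace_of_shift {θ : Linf} (W : Submodule ℂ (modelSpace θ))
    [FiniteDimensional ℂ W] {b : L2} (hb : b ∈ H2ᗮ) (hb0 : b ≠ 0)
    (h : ∀ n : ℕ, modelProj θ (mulOp (fourierLp ∞ (n : ℤ)) b) ∈ W) :
    FiniteDimensional ℂ (modelSpace θ) := by
  rw [mem_H2_orthogonal] at hb
  refine finiteDimensional_modelSpace_of_total W (fun k : ℕ => fourierLp 2 (k : ℤ))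
    (mem_of_convolution_mem (e := fun k : ℕ => modelProj θ (fourierLp 2 (k : ℤ)))
      (c := fun i => fourierCoeff b (-1 - i)) ?_ fun n => ?_) ?_
  · by_contra! hc
    refine hb0 (eq_zero_of_fourierCoeff fun n => ?_)
    rcases lt_or_ge n 0 with hn | hn
    · have := hc (-1 - n).toNat
      rwa [show (-1 - ((-1 - n).toNat : ℤ)) = n by lia] at this
    · exact hb n hn
  -- Since `b` starts at `ξ⁻¹`, the part of `ξⁿ⁺¹b` with nonnegative frequencies is a combination of
  -- `1, …, ξⁿ`; the rest is killed by `P_θ`.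
  · have key : mulOp (fourierLp ∞ ((n + 1 : ℕ) : ℤ)) b -
        ∑ k ∈ Finset.range (n + 1), fourierCoeff b (-1 - (n - k : ℕ)) • fourierLp 2 (k : ℤ) ∈
          H2ᗮ := by
      rw [mem_H2_orthogonal]
      intro m hm
      obtain ⟨m, rfl⟩ := Int.eq_ofNat_of_zero_le hm
      rw [fourierCoeff_sub_L2, fourierCoeff_mulOp_fourierLp, fourierCoeff_sum_smul_L2]
      simp only [fourierCoeff_fourierLp, Nat.cast_inj, mul_ite, mul_one, mul_zero,
        Finset.sum_ite_eq, Finset.mem_range]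
      split_ifs with hmn
      · rw [sub_eq_zero]
        congr 1
        lia
      · rw [sub_zero]
        exact hb _ (by lia)
    have h1 := modelProj_eq_zero_of_mem_orthogonal θ key
    rw [map_sub, sub_eq_zero, map_sum] at h1
    simp only [map_smul] at h1
    rw [← h1]
    exact h _
  · intro f hf h0
    refine eq_zero_of_fourierCoeff fun n => ?_
    rcases lt_or_ge n 0 with hn | hn
    · exact hf.1 n hn
    · obtain ⟨n, rfl⟩ := Int.eq_ofNat_of_zero_le hn
      rw [fourierCoeff_eq_inner]
      exact h0 n

/-- If the projections to `K_θ` of all `ξ⁻ⁿ θ a` lie in a finite-dimensional space, where `a ≠ 0`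
belongs to `H²`, then `K_θ` is finite-dimensional. -/
theorem finiteDimensional_modelSpace_of_backward_shift {θ : Linf} (hθ : IsInner θ)
    (W : Submodule ℂ (modelSpace θ)) [FiniteDimensional ℂ W] {a : L2} (ha : a ∈ H2) (ha0 : a ≠ 0)
    (h : ∀ n : ℕ, modelProj θ (mulOp (fourierLp ∞ (-(n : ℤ))) (mulOp θ a)) ∈ W) :
    FiniteDimensional ℂ (modelSpace θ) := by
  rw [mem_H2] at ha
  refine finiteDimensional_modelSpace_of_total W
    (fun k : ℕ => mulOp θ (fourierLp 2 (-1 - (k : ℤ))))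
    (mem_of_convolution_mem
      (e := fun k : ℕ => modelProj θ (mulOp θ (fourierLp 2 (-1 - (k : ℤ)))))
      (c := fun i => fourierCoeff a i) ?_ fun n => ?_) ?_
  · by_contra! hc
    refine ha0 (eq_zero_of_fourierCoeff fun n => ?_)
    rcases lt_or_ge n 0 with hn | hn
    · exact ha n hn
    · obtain ⟨n, rfl⟩ := Int.eq_ofNat_of_zero_le hn
      exact hc n
  -- Here the negative-frequency part of `ξ⁻ⁿ⁻¹a` involves only `ξ⁻¹, …, ξ⁻ⁿ⁻¹`; the remainder is in
  -- `H²`, so `θ` times it is killed by `P_θ`.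
  · have key : mulOp (fourierLp ∞ (-((n + 1 : ℕ) : ℤ))) a -
        ∑ k ∈ Finset.range (n + 1), fourierCoeff a (n - k : ℕ) • fourierLp 2 (-1 - (k : ℤ)) ∈
          H2 := by
      intro m hm
      obtain ⟨m, rfl⟩ : ∃ k : ℕ, m = -1 - k := ⟨(-1 - m).toNat, by lia⟩
      rw [fourierCoeff_sub_L2, fourierCoeff_mulOp_fourierLp, fourierCoeff_sum_smul_L2]
      simp only [fourierCoeff_fourierLp, sub_right_inj, Nat.cast_inj, mul_ite, mul_one, mul_zero,
        Finset.sum_ite_eq, Finset.mem_range]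
      split_ifs with hmn
      · rw [sub_eq_zero]
        congr 1
        lia
      · rw [sub_zero]
        exact ha _ (by lia)
    have h1 := modelProj_mulOp θ key
    rw [map_sub, map_sub, sub_eq_zero, map_sum, map_sum, mulOp_comm] at h1
    simp only [map_smul] at h1
    rw [← h1]
    exact h _
  · intro f hf h0
    -- Orthogonality to `θH²` removes the nonnegative coefficients of `θ̄f`, and `h0` removes the
    -- negative ones.
    have h1 : mulOp (star θ) f = 0 := by
      refine eq_zero_of_fourierCoeff fun n => ?_
      rw [fourierCoeff_eq_inner, ← inner_mulOp_left]
      rcases lt_or_ge n 0 with hn | hn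
      · obtain ⟨k, rfl⟩ : ∃ k : ℕ, n = -1 - k := ⟨(-1 - n).toNat, by lia⟩
        exact h0 k
      · exact hf.2 _ (Submodule.mem_map_of_mem (fourierLp_mem_H2 hn))
    rw [← mulOp_star_mulOp hθ f, mulOp_comm, h1, map_zero]

theorem exists_polynomial_of_finiteDimensional {V : Type*} [AddCommGroup V] [Module ℂ V]
    (A : ℂ[X] →ₗ[ℂ] V) (W : Submodule ℂ V) [FiniteDimensional ℂ W] (h : ∀ p, A p ∈ W) :
    ∃ p : ℂ[X], p ≠ 0 ∧ A p = 0 := by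
  by_contra! hA
  have hinj : Function.Injective (A.codRestrict W h) := by
    rw [← LinearMap.ker_eq_bot, LinearMap.ker_codRestrict, LinearMap.ker_eq_bot']
    intro p hp
    by_contra hp0
    exact hA p hp0 hp
  exact Polynomial.not_finite (R := ℂ) (Module.Finite.of_injective _ hinj)

/-! ### Finite Blaschke products -/

theorem fourierCoeff_conj (f : UnitAddCircle → ℂ) (n : ℤ) :
    fourierCoeff (fun t => conj (f t)) n = conj (fourierCoeff f (-n)) := by
  rw [fourierCoeff, fourierCoeff, ← integral_conj]
  refine integral_congr_ae (Filter.Eventually.of_forall fun t => ?_)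
  simp only [smul_eq_mul, map_mul]
  rw [← fourier_neg, neg_neg]

theorem one_sub_conj_mul_ne_zero {a z : ℂ} (ha : ‖a‖ < 1) (hz : ‖z‖ = 1) :
    1 - conj a * z ≠ 0 := by
  intro h
  rw [sub_eq_zero] at h
  have h1 := congrArg norm h
  rw [norm_one, norm_mul, hz, mul_one, RCLike.norm_conj] at h1
  exact ha.ne h1.symm

theorem mul_conj_sub_eq {a z : ℂ} (hz : ‖z‖ = 1) : z * conj (z - a) = 1 - conj a * z := by
  have h : z * conj z = 1 := by rw [mul_comm]; exact conj_mul_self_of_norm_eq_one hz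
  rw [map_sub, mul_sub, h, mul_comm z]

theorem norm_one_sub_conj_mul {a z : ℂ} (hz : ‖z‖ = 1) : ‖1 - conj a * z‖ = ‖z - a‖ := by
  rw [← mul_conj_sub_eq hz, norm_mul, hz, one_mul, RCLike.norm_conj]

/-- If `θ` and `θ̄` are both Hardy, only the zeroth coefficient survives, so `θ` is a unimodular
constant, the empty Blaschke product. -/
theorem isFiniteBlaschke_of_isHardy_conj {θ : Linf} (hθ : IsInner θ)
    (h : IsHardy fun t => conj (θ t)) : IsFiniteBlaschke θ := by
  have hmem : MemLp θ 2 haarAddCircle := (IsHardy.of_mem_Hinf hθ.1).memLp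
  have hcoeff : ∀ n : ℤ, n ≠ 0 → fourierCoeff θ n = 0 := fun n hn => by
    rcases lt_or_gt_of_ne hn with hn | hn
    · exact hθ.1 n hn
    · have := h.coeff (-n) (by lia)
      rwa [fourierCoeff_conj, neg_neg, map_eq_zero] at this
  have heq : hmem.toLp θ = fourierCoeff θ 0 • fourierLp 2 0 := by
    refine eq_of_fourierCoeff_eq fun n => ?_
    rw [fourierCoeff_toLp, fourierCoeff_eq_inner (_ • _), inner_smul_right,
      ← fourierCoeff_eq_inner, fourierCoeff_fourierLp]
    split_ifs with hn
    · rw [hn, mul_one]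
    · rw [hcoeff n hn, mul_zero]
  have hae : ∀ᵐ t ∂haarAddCircle, θ t = fourierCoeff θ 0 := by
    filter_upwards [hmem.coeFn_toLp, Lp.coeFn_smul (fourierCoeff θ 0) (fourierLp (T := 1) 2 0),
      coeFn_fourierLp (T := 1) 2 0] with t h1 h2 h3
    rw [← h1, heq, h2, Pi.smul_apply, h3, fourier_zero, smul_eq_mul, mul_one]
  obtain ⟨t, h1, h2⟩ := (hae.and hθ.2).exists
  refine ⟨0, Fin.elim0, fourierCoeff θ 0, by rw [← h1, h2], fun k => k.elim0, ?_⟩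
  filter_upwards [hae] with t ht
  rw [ht, Finset.univ_eq_empty, Finset.prod_empty, mul_one]

/-- An inner function dividing a nonzero polynomial in `H²` is a finite Blaschke product. -/
theorem isFiniteBlaschke_of_isHardy_conj_mul {p : ℂ[X]} (hp : p ≠ 0) {θ : Linf} (hθ : IsInner θ)
    (H : IsHardy fun t => conj (θ t) * p.eval (fourier 1 t : ℂ)) : IsFiniteBlaschke θ := by
  induction p, hp using polynomial_induction_linear generalizing θ with
  | hC c hc =>
    refine isFiniteBlaschke_of_isHardy_conj hθ ?_
    convert H.const_mul c⁻¹ using 2 with t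
    rw [eval_C]
    field_simp
  | hmul a p hp ih =>
    have hθ2 := IsHardy.of_mem_Hinf hθ.1
    have hw : MemLp (fun t => conj (θ t) * p.eval (fourier 1 t : ℂ)) 2 haarAddCircle :=
      memLp_mul (Lp.memLp θ).star (memLp_of_continuous (continuous_eval_fourier p) _)
    have Hw : IsHardy fun t =>
        ((fourier 1 t : ℂ) - a) * (conj (θ t) * p.eval (fourier 1 t : ℂ)) := by
      convert H using 2 with t
      simp only [Polynomial.eval_mul, eval_sub, eval_X, eval_C]
      ring
    rcases lt_or_ge ‖a‖ 1 with ha | ha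
    · obtain ⟨c, hc⟩ := IsHardy.sub_div hw ha Hw
      rcases eq_or_ne c 0 with rfl | hc0
      · exact ih hθ (by simpa only [zero_mul, sub_zero] using hc)
      -- Multiplying `θ̄p - c/(ξ-a)` by `θ` gives `p - cθ/(ξ-a)`; with `c ≠ 0`, the function `θ` is
      -- divisible by `ξ - a` in `H²`.
      have hquot : IsHardy fun t => θ t * ((fourier 1 t : ℂ) - a)⁻¹ := by
        refine (((IsHardy.eval p).sub (hθ2.mul (Lp.memLp θ) hc)).const_mul c⁻¹).congr ?_
        filter_upwards [hθ.2] with t ht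
        have h1 := conj_mul_self_of_norm_eq_one ht
        have h2 : p.eval (fourier 1 t : ℂ) - θ t * (conj (θ t) * p.eval (fourier 1 t : ℂ) -
            c * ((fourier 1 t : ℂ) - a)⁻¹) = c * (θ t * ((fourier 1 t : ℂ) - a)⁻¹) := by
          linear_combination -(p.eval (fourier 1 t : ℂ)) * h1
        rw [h2, inv_mul_cancel_left₀ hc0]
      -- The Blaschke factor at `a` is split off: `θ' = (1 - āξ)θ/(ξ - a)` is again inner. On the
      -- circle `(1 - āξ)·conj(θ')·p = (ξ - a)θ̄p`, which is Hardy, and `1 - āξ` can be divided out,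
      -- so induction applies to `θ'`.
      set d : ℂ[X] := 1 - C (conj a) * X with hd
      have hde : ∀ z : ℂ, d.eval z = 1 - conj a * z := fun z => by simp [hd]
      have hbdd : MemLp (fun t => d.eval (fourier 1 t : ℂ) * (θ t * ((fourier 1 t : ℂ) - a)⁻¹)) ∞
          haarAddCircle :=
        memLp_mul (memLp_of_continuous (continuous_eval_fourier d) _)
          (memLp_mul (Lp.memLp θ) (memLp_inv_fourier_sub ha _))
      have hθ' : IsInner (hbdd.toLp _) := by
        refine ⟨fun n hn => ?_, ?_⟩
        · rw [fourierCoeff_toLp]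
          exact (hquot.eval_mul d).coeff n hn
        · filter_upwards [hbdd.coeFn_toLp, hθ.2] with t h1 h2
          rw [h1, hde, norm_mul, norm_mul, h2, one_mul, norm_inv,
            norm_one_sub_conj_mul (norm_fourier_apply 1 t), mul_inv_cancel₀]
          exact norm_ne_zero_iff.2 (fourier_sub_ne_zero ha t)
      obtain ⟨n, b, c', hc', hb, hprod⟩ := ih hθ' (by
        refine IsHardy.of_linear_mul (α := 1) (β := -conj a)
          (memLp_mul (Lp.memLp _).star (memLp_of_continuous (continuous_eval_fourier p) _))
          one_ne_zero (by simpa using ha.le) (Hw.congr ?_)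
        filter_upwards [hbdd.coeFn_toLp] with t h1
        have hz := norm_fourier_apply 1 t
        have hza := fourier_sub_ne_zero ha t
        have h2 := mul_conj_sub_eq (a := a) hz
        have h3 : conj (1 - conj a * fourier 1 t : ℂ) * fourier 1 t = fourier 1 t - a := by
          rw [← h2, map_mul, Complex.conj_conj]
          linear_combination ((fourier 1 t : ℂ) - a) * conj_mul_self_of_norm_eq_one hz
        have h4 : conj ((fourier 1 t : ℂ) - a) ≠ 0 := by rwa [_root_.map_ne_zero]
        rw [h1, hde, map_mul, map_mul, map_inv₀, neg_mul, ← sub_eq_add_neg, ← h2]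
        rw [← h2] at h3
        field_simp
        linear_combination -(conj (θ t) * p.eval (fourier 1 t : ℂ)) * h3)
      refine ⟨n + 1, Fin.cons a b, c', hc', Fin.cases ha hb, ?_⟩
      filter_upwards [hbdd.coeFn_toLp, hprod] with t h1 h2
      rw [Fin.prod_univ_succ]
      simp only [Fin.cons_zero, Fin.cons_succ]
      rw [mul_left_comm, ← h2, h1, hde]
      have h3 := one_sub_conj_mul_ne_zero ha (norm_fourier_apply 1 t)
      have h4 := fourier_sub_ne_zero ha t
      generalize 1 - conj a * (fourier 1 t : ℂ) = w at h3 ⊢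
      field_simp
    · refine ih hθ (IsHardy.of_linear_mul (α := -a) (β := 1) hw ?_ (by simpa using ha) ?_)
      · rw [neg_ne_zero]; rintro rfl; simp at ha; linarith
      · convert Hw using 2 with t
        ring

theorem isFiniteBlaschke_of_finiteDimensional {θ : Linf} (hθ : IsInner θ)
    [FiniteDimensional ℂ (modelSpace θ)] : IsFiniteBlaschke θ := by
  obtain ⟨p, hp, hp0⟩ := exists_polynomial_of_finiteDimensional
    ((modelProj θ).toLinearMap ∘ₗ polyL2) ⊤ fun _ => Submodule.mem_top
  obtain ⟨a, ha, b, hb, hab⟩ := exists_of_modelProj_eq_zero hθ hp0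
  -- `b = p - θa` lies both in `H²` and in its orthogonal complement.
  have hb0 : b = 0 := by
    rw [← Submodule.mem_bot ℂ, ← H2.inf_orthogonal_eq_bot]
    refine ⟨?_, hb⟩
    rw [← sub_eq_iff_eq_add'.2 hab]
    exact Submodule.sub_mem _ (polyL2_mem_H2 p) (mulOp_mem_H2 hθ.1 ha)
  rw [hb0, add_zero] at hab
  refine isFiniteBlaschke_of_isHardy_conj_mul hp hθ ((IsHardy.of_mem_H2 ha).congr ?_)
  filter_upwards [polyL2_coeFn p, mulOp_coeFn θ a, hθ.2] with t h1 h2 h3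
  rw [← h1, hab, h2, ← mul_assoc, conj_mul_self_of_norm_eq_one h3, one_mul]

/-! ### Finite rank -/

/-- An operator vanishing on `q H²`, where `q` is a polynomial with all zeros in the open disk, has
finite rank on `H²`. -/
theorem finiteDimensional_map_H2 {V : Type*} [AddCommGroup V] [Module ℂ V] (A : L2 →ₗ[ℂ] V)
    {q : ℂ[X]} (hq0 : q ≠ 0) (hq : ∀ z : ℂ, q.eval z = 0 → ‖z‖ < 1)
    (hA : ∀ f : L2, ∀ k ∈ H2, (∀ᵐ t ∂haarAddCircle, f t = q.eval (fourier 1 t : ℂ) * k t) →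
      A f = 0) : FiniteDimensional ℂ (H2.map A) := by
  have : FiniteDimensional ℂ (degreeLT ℂ q.natDegree) :=
    Module.Finite.equiv (degreeLTEquiv ℂ q.natDegree).symm
  refine Submodule.finiteDimensional_of_le (S₂ := (degreeLT ℂ q.natDegree).map (A ∘ₗ polyL2)) ?_
  rintro _ ⟨f, hf, rfl⟩
  have hw : MemLp (fun t => (q.eval (fourier 1 t : ℂ))⁻¹ * f t) 2 haarAddCircle :=
    memLp_mul (memLp_of_continuous ((continuous_eval_fourier q).inv₀ (eval_fourier_ne_zero hq)) _)
      (Lp.memLp f)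
  -- Dividing `f` by `q` leaves `f/q - p/q = k ∈ H²`, so `f - p = qk` is killed by `A` and `A f = A
  -- p` with `deg p < deg q`.
  obtain ⟨p, hp, H⟩ := IsHardy.sub_eval_div_eval hq0 hq hw (by
    convert IsHardy.of_mem_H2 hf using 2 with t
    exact mul_inv_cancel_left₀ (eval_fourier_ne_zero hq t) _)
  refine ⟨p, ?_, ?_⟩
  · rw [SetLike.mem_coe, mem_degreeLT, ← degree_eq_natDegree hq0]
    exact hp
  · have h := hA (f - polyL2 p) _ H.toLp_mem_H2 (by
      filter_upwards [Lp.coeFn_sub f (polyL2 p), polyL2_coeFn p, H.memLp.coeFn_toLp]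
        with t h1 h2 h3
      have := eval_fourier_ne_zero hq t
      rw [h1, Pi.sub_apply, h2, h3]
      field_simp)
    rw [map_sub, sub_eq_zero] at h
    exact h.symm

/-- With `q = ∏(z - aₖ)`, one has `qk = θ · c̄∏(1 - āₖz)k ∈ θH²` for `k ∈ H²`, so `P_θ` kills `qH²`,
while it maps `H²` onto `K_θ`. -/
theorem IsFiniteBlaschke.finiteDimensional_modelSpace {θ : Linf} (h : IsFiniteBlaschke θ) :
    FiniteDimensional ℂ (modelSpace θ) := by
  obtain ⟨n, a, c, hc, ha, hθ⟩ := h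
  have hmap : H2.map (modelProj θ).toLinearMap = ⊤ := by
    rw [eq_top_iff]
    intro f _
    exact ⟨f, f.2.1, Submodule.orthogonalProjectionOnto_mem_subspace_eq_self f⟩
  have hfin := finiteDimensional_map_H2 (modelProj θ).toLinearMap
    (q := ∏ k, (X - C (a k))) (Finset.prod_ne_zero_iff.2 fun k _ => X_sub_C_ne_zero _)
    (fun z hz => by
      rw [eval_prod, Finset.prod_eq_zero_iff] at hz
      obtain ⟨k, -, hk⟩ := hz
      rw [eval_sub, eval_X, eval_C, sub_eq_zero] at hk
      rw [hk]
      exact ha k)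
    (fun f k hk hf => by
      have hd := ((IsHardy.of_mem_H2 hk).eval_mul (∏ k, (1 - C (conj (a k)) * X))).const_mul
        (conj c)
      suffices f = mulOp θ (hd.memLp.toLp _) by
        rw [this]
        exact modelProj_mulOp θ hd.toLp_mem_H2
      refine (mulOp_eq_of_ae ?_).symm
      filter_upwards [hf, hd.memLp.coeFn_toLp, hθ] with t h1 h2 h3
      have h4 : ∏ k, (1 - conj (a k) * (fourier 1 t : ℂ)) ≠ 0 :=
        Finset.prod_ne_zero_iff.2 fun k _ =>
          one_sub_conj_mul_ne_zero (ha k) (norm_fourier_apply 1 t)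
      have h5 := conj_mul_self_of_norm_eq_one hc
      rw [h1, h2, h3, Finset.prod_div_distrib, eval_prod, eval_prod]
      simp only [eval_sub, eval_X, eval_C, eval_one, Polynomial.eval_mul]
      generalize ∏ k, (1 - conj (a k) * (fourier 1 t : ℂ)) = D at h4 ⊢
      field_simp
      linear_combination -((∏ k, ((fourier 1 t : ℂ) - a k)) * k t) * h5)
  rw [hmap] at hfin
  exact Module.Finite.equiv (Submodule.topEquiv (R := ℂ) (M := modelSpace θ))

/-- After the roots of `p` outside the disk are cancelled, division by the remaining `q` leaves a
Hardy function; it is bounded, being the difference of `f` and a rational function without poles on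
the circle. -/
theorem mem_HinfAddRatl_of_isHardy {f : Linf} {p : ℂ[X]} (hp : p ≠ 0)
    (H : IsHardy fun t => p.eval (fourier 1 t : ℂ) * f t) : f ∈ HinfAddRatl := by
  have hf : MemLp f 2 haarAddCircle := (Lp.memLp f).mono_exponent le_top
  obtain ⟨q, hq0, hq, Hq⟩ := IsHardy.exists_zeros_mem_disk hp hf H
  obtain ⟨r, -, Hr⟩ := IsHardy.sub_eval_div_eval hq0 hq hf Hq
  have hr := memLp_eval_div_eval r hq ∞
  refine ⟨f - hr.toLp _, (Hr.congr ?_).coeff, hr.toLp _, ⟨r, q, hq0, hq, hr.coeFn_toLp⟩,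
    (sub_add_cancel _ _).symm⟩
  filter_upwards [Lp.coeFn_sub f (hr.toLp _), hr.coeFn_toLp] with t h1 h2
  rw [h1, Pi.sub_apply, h2]

theorem isHardy_mul_of_mem_HinfAddRatl {f : Linf} (hf : f ∈ HinfAddRatl) :
    ∃ q : ℂ[X], q ≠ 0 ∧ (∀ z : ℂ, q.eval z = 0 → ‖z‖ < 1) ∧
      ∀ k ∈ H2, IsHardy fun t => f t * (q.eval (fourier 1 t : ℂ) * k t) := by
  obtain ⟨g, hg, r, ⟨p, q, hq0, hq, hr⟩, rfl⟩ := hf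
  refine ⟨q, hq0, hq, fun k hk => ?_⟩
  have hk' := IsHardy.of_mem_H2 hk
  refine (((IsHardy.of_mem_Hinf hg).mul (Lp.memLp g) (hk'.eval_mul q)).add
    (hk'.eval_mul p)).congr ?_
  filter_upwards [hr, Lp.coeFn_add g r] with t h1 h2
  have := eval_fourier_ne_zero hq t
  rw [h2, Pi.add_apply, h1]
  field_simp

theorem range_restrictedToeplitz (η θ φ : Linf) :
    (restrictedToeplitz η θ φ).range =
      H2.map (modelProj θ ∘L mulOp φ ∘L mulOp η).toLinearMap := by
  ext y
  constructor
  · rintro ⟨⟨_, h, hh, rfl⟩, rfl⟩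
    exact ⟨h, hh, rfl⟩
  · rintro ⟨h, hh, rfl⟩
    exact ⟨⟨mulOp η h, Submodule.mem_map_of_mem hh⟩, rfl⟩

theorem range_restrictedHankel (η θ φ : Linf) :
    (restrictedHankel η θ φ).range =
      H2.map (modelProj θ ∘L flipOp ∘L mulOp φ ∘L mulOp η).toLinearMap := by
  ext y
  constructor
  · rintro ⟨⟨_, h, hh, rfl⟩, rfl⟩
    exact ⟨h, hh, rfl⟩
  · rintro ⟨h, hh, rfl⟩
    exact ⟨⟨mulOp η h, Submodule.mem_map_of_mem hh⟩, rfl⟩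

theorem mulOp_mulOp_polyL2 (φ η : Linf) (n : ℕ) (p : ℂ[X]) :
    mulOp φ (mulOp η (polyL2 (X ^ n * p))) =
      mulOp (fourierLp ∞ (n : ℤ)) (mulOp φ (mulOp η (polyL2 p))) := by
  rw [← mulOp_polyL2, mulOp_comm η, mulOp_comm φ]

theorem mulOp_mulOp_polyL2_coeFn (φ η : Linf) (p : ℂ[X]) :
    ∀ᵐ t ∂haarAddCircle, mulOp φ (mulOp η (polyL2 p)) t =
      φ t * (η t * p.eval (fourier 1 t : ℂ)) := by
  filter_upwards [mulOp_coeFn φ (mulOp η (polyL2 p)), mulOp_coeFn η (polyL2 p), polyL2_coeFn p]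
    with t h1 h2 h3
  rw [h1, h2, h3]

theorem mulOp_fourierLp_neg_mem_H2_orthogonal (n : ℕ) {b : L2} (hb : b ∈ H2ᗮ) :
    mulOp (fourierLp ∞ (-(n : ℤ))) b ∈ H2ᗮ := by
  rw [mem_H2_orthogonal] at hb ⊢
  intro m hm
  rw [fourierCoeff_mulOp_fourierLp]
  exact hb _ (by lia)

/-! ### Necessity. -/

theorem mem_of_isFiniteRank_restrictedToeplitz {φ η θ : Linf} (hη : IsInner η) (hθ : IsInner θ)
    (h : IsFiniteRank (restrictedToeplitz η θ φ)) :
    (∃ f ∈ HinfAddRatl, ∀ᵐ t ∂haarAddCircle, φ t = conj (η t) * θ t * f t) ∨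
      IsFiniteBlaschke θ := by
  rw [IsFiniteRank, range_restrictedToeplitz] at h
  set A : L2 →L[ℂ] modelSpace θ := modelProj θ ∘L mulOp φ ∘L mulOp η with hA
  have hmem : ∀ p, (A.toLinearMap ∘ₗ polyL2) p ∈ H2.map A.toLinearMap := fun p =>
    Submodule.mem_map_of_mem (polyL2_mem_H2 p)
  obtain ⟨p, hp, hp0⟩ := exists_polynomial_of_finiteDimensional _ _ hmem
  obtain ⟨a, ha, b, hb, hab⟩ := exists_of_modelProj_eq_zero hθ hp0
  rcases eq_or_ne b 0 with rfl | hb0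
  · left
    have hf : MemLp (fun t => conj (θ t) * (φ t * η t)) ∞ haarAddCircle :=
      memLp_mul (Lp.memLp θ).star (memLp_mul (Lp.memLp φ) (Lp.memLp η))
    refine ⟨hf.toLp _, mem_HinfAddRatl_of_isHardy hp ((IsHardy.of_mem_H2 ha).congr ?_), ?_⟩
    · filter_upwards [hf.coeFn_toLp, mulOp_mulOp_polyL2_coeFn φ η p, mulOp_coeFn θ a, hθ.2]
        with t h1 h2 h3 h4
      have h5 : φ t * (η t * p.eval (fourier 1 t : ℂ)) = θ t * a t := by
        rw [← h2, ← h3]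
        exact congrArg (fun x : L2 => x t) (hab.trans (add_zero _))
      rw [h1]
      linear_combination -conj (θ t) * h5 - a t * conj_mul_self_of_norm_eq_one h4
    · filter_upwards [hf.coeFn_toLp, hθ.2, hη.2] with t h1 h2 h3
      rw [h1]
      linear_combination -φ t * conj_mul_self_of_norm_eq_one h3 -
        φ t * conj (η t) * η t * conj_mul_self_of_norm_eq_one h2
  · right
    have : FiniteDimensional ℂ (modelSpace θ) := by
      refine finiteDimensional_modelSpace_of_shift (H2.map A.toLinearMap) hb hb0 fun n => ?_
      -- Multiplication by `ξⁿ` keeps `θa` inside `θH²`, so only `b` contributes.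
      have h1 : A (polyL2 (X ^ n * p)) = modelProj θ (mulOp (fourierLp ∞ (n : ℤ)) b) := by
        have hab' : mulOp φ (mulOp η (polyL2 p)) = mulOp θ a + b := hab
        have hza : mulOp (fourierLp ∞ (n : ℤ)) a ∈ H2 := fun m hm => by
          rw [fourierCoeff_mulOp_fourierLp]
          exact ha _ (by lia)
        rw [hA, ContinuousLinearMap.comp_apply, ContinuousLinearMap.comp_apply,
          mulOp_mulOp_polyL2, hab', map_add, map_add, mulOp_comm, modelProj_mulOp θ hza, zero_add]
      rw [← h1]
      exact hmem _
    exact isFiniteBlaschke_of_finiteDimensional hθ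

theorem mem_of_isFiniteRank_restrictedHankel {φ η θ : Linf} (hη : IsInner η) (hθ : IsInner θ)
    (h : IsFiniteRank (restrictedHankel η θ φ)) :
    (∃ f ∈ HinfAddRatl, ∀ᵐ t ∂haarAddCircle, φ t = conj (η t) * f t) ∨
      IsFiniteBlaschke θ := by
  rw [IsFiniteRank, range_restrictedHankel] at h
  set A : L2 →L[ℂ] modelSpace θ := modelProj θ ∘L flipOp ∘L mulOp φ ∘L mulOp η with hA
  have hmem : ∀ p, (A.toLinearMap ∘ₗ polyL2) p ∈ H2.map A.toLinearMap := fun p =>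
    Submodule.mem_map_of_mem (polyL2_mem_H2 p)
  obtain ⟨p, hp, hp0⟩ := exists_polynomial_of_finiteDimensional _ _ hmem
  obtain ⟨a, ha, b, hb, hab⟩ := exists_of_modelProj_eq_zero hθ hp0
  have hab' : flipOp (mulOp φ (mulOp η (polyL2 p))) = mulOp θ a + b := hab
  rcases eq_or_ne a 0 with rfl | ha0
  · left
    rw [map_zero, zero_add] at hab'
    rw [← hab', flipOp_mem_H2_orthogonal_iff] at hb
    have hf : MemLp (fun t => φ t * η t) ∞ haarAddCircle := memLp_mul (Lp.memLp φ) (Lp.memLp η)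
    refine ⟨hf.toLp _, mem_HinfAddRatl_of_isHardy hp ((IsHardy.of_mem_H2 hb).congr ?_), ?_⟩
    · filter_upwards [hf.coeFn_toLp, mulOp_mulOp_polyL2_coeFn φ η p] with t h1 h2
      rw [h1, h2]
      ring
    · filter_upwards [hf.coeFn_toLp, hη.2] with t h1 h2
      rw [h1]
      linear_combination -φ t * conj_mul_self_of_norm_eq_one h2
  · right
    have : FiniteDimensional ℂ (modelSpace θ) := by
      refine finiteDimensional_modelSpace_of_backward_shift hθ (H2.map A.toLinearMap) ha ha0
        fun n => ?_
      -- Because `𝒥` turns `ξⁿ` into `ξ⁻ⁿ`, it is now `b` that stays in the kernel of `P_θ` and `θa`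
      -- that contributes.
      have h1 : A (polyL2 (X ^ n * p)) =
          modelProj θ (mulOp (fourierLp ∞ (-(n : ℤ))) (mulOp θ a)) := by
        rw [hA, ContinuousLinearMap.comp_apply, ContinuousLinearMap.comp_apply,
          ContinuousLinearMap.comp_apply, mulOp_mulOp_polyL2, flipOp_mulOp_fourierLp, hab',
          map_add, map_add, modelProj_eq_zero_of_mem_orthogonal θ
            (mulOp_fourierLp_neg_mem_H2_orthogonal n hb), add_zero]
      rw [← h1]
      exact hmem _
    exact isFiniteBlaschke_of_finiteDimensional hθ

/-! ### Sufficiency. -/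

theorem isFiniteRank_restrictedToeplitz {φ η θ f : Linf} (hη : IsInner η)
    (hf : f ∈ HinfAddRatl) (h : ∀ᵐ t ∂haarAddCircle, φ t = conj (η t) * θ t * f t) :
    IsFiniteRank (restrictedToeplitz η θ φ) := by
  rw [IsFiniteRank, range_restrictedToeplitz]
  obtain ⟨q, hq0, hq, Hq⟩ := isHardy_mul_of_mem_HinfAddRatl hf
  refine finiteDimensional_map_H2 _ hq0 hq fun x k hk hx => ?_
  -- For `x = qk`, `φηx = θ(fqk)` with `fqk ∈ H²`, because `q` clears the denominator of `f`.
  have hmul : mulOp φ (mulOp η x) = mulOp θ ((Hq k hk).memLp.toLp _) := by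
    refine mulOp_eq_of_ae ?_
    filter_upwards [mulOp_coeFn θ ((Hq k hk).memLp.toLp _), (Hq k hk).memLp.coeFn_toLp,
      mulOp_coeFn η x, hx, h, hη.2] with t h1 h2 h3 h4 h5 h6
    rw [h1, h2, h3, h4, h5]
    linear_combination -(θ t * f t * (q.eval (fourier 1 t : ℂ) * k t)) *
      conj_mul_self_of_norm_eq_one h6
  rw [ContinuousLinearMap.coe_coe, ContinuousLinearMap.comp_apply, ContinuousLinearMap.comp_apply,
    hmul]
  exact modelProj_mulOp θ (Hq k hk).toLp_mem_H2

theorem isFiniteRank_restrictedHankel {φ η θ f : Linf} (hη : IsInner η)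
    (hf : f ∈ HinfAddRatl) (h : ∀ᵐ t ∂haarAddCircle, φ t = conj (η t) * f t) :
    IsFiniteRank (restrictedHankel η θ φ) := by
  rw [IsFiniteRank, range_restrictedHankel]
  obtain ⟨q, hq0, hq, Hq⟩ := isHardy_mul_of_mem_HinfAddRatl hf
  refine finiteDimensional_map_H2 _ hq0 hq fun x k hk hx => ?_
  refine modelProj_eq_zero_of_mem_orthogonal θ (flipOp_mem_H2_orthogonal_iff.2
    ((Hq k hk).mem_H2_of_ae_eq ?_))
  filter_upwards [mulOp_coeFn φ (mulOp η x), mulOp_coeFn η x, hx, h, hη.2] with t h1 h2 h3 h4 h5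
  refine h1.trans ?_
  rw [h2, h3, h4]
  linear_combination (f t * (q.eval (fourier 1 t : ℂ) * k t)) * conj_mul_self_of_norm_eq_one h5

end RestrictedToeplitz

theorem mainTheorem5 (φ η θ : Linf) (hη : IsInner η) (hθ : IsInner θ) :
    (IsFiniteRank (restrictedToeplitz η θ φ) ↔
      (∃ f ∈ HinfAddRatl, ∀ᵐ t ∂haarAddCircle, φ t = conj (η t) * θ t * f t) ∨
        IsFiniteBlaschke θ) ∧
    (IsFiniteRank (restrictedHankel η θ φ) ↔
      (∃ f ∈ HinfAddRatl, ∀ᵐ t ∂haarAddCircle, φ t = conj (η t) * f t) ∨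
        IsFiniteBlaschke θ) := by
  refine ⟨⟨mem_of_isFiniteRank_restrictedToeplitz hη hθ, ?_⟩,
    ⟨mem_of_isFiniteRank_restrictedHankel hη hθ, ?_⟩⟩
  · rintro (⟨f, hf, h⟩ | h)
    · exact isFiniteRank_restrictedToeplitz hη hf h
    · have := h.finiteDimensional_modelSpace
      exact inferInstanceAs (FiniteDimensional ℂ (restrictedToeplitz η θ φ).range)
  · rintro (⟨f, hf, h⟩ | h)
    · exact isFiniteRank_restrictedHankel hη hf h
    · have := h.finiteDimensional_modelSpace
      exact inferInstanceAs (FiniteDimensional ℂ (restrictedHankel η θ φ).range)
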